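/- **Joyal's completeness theorem.** Let $\mathbf C$ be a (locally small) essentially small category with pushouts. *Definitions.* A function between posets is *bounded* if direct images of up-sets are up-sets. A square of order-preserving maps $f\colon A\to B$, $g\colon A\to C$, $u\colon B\to D$, $v\colon C\to D$ with $u\circ f\le v\circ g$ has the *interpolation property* if for all $b\in B$, $c\in C$ with $u(b)\le v(c)$ there is $a\in A$ with $b\le f(a)$ and $g(a)\le c$. A *polyadic poset* is a functor $\mathbf C^{\mathrm{op}}\to\mathbf{Poset}$ sending every morphism to a bounded map and every pushout square to a square with the interpolation property. A *polyadic compact ordered space* is a functor $S\colon\mathbf C^{\mathrm{op}}\to\mathbf{KOrd}$ with these two properties, where $\mathbf{KOrd}$ is the category of compact spaces with a closed partial order and continuous order-preserving maps. A natural transformation $\tau\colon P\to Q$ of polyadic posets is *intuitionistic* if each $\tau_n$ is bounded and, for every $\sigma\colon n\to m$ in $\mathbf C$, the naturality square with sides $P(\sigma),\tau_n,\tau_m,Q(\sigma)$ has the interpolation property in both orientations, i.e. $Q(\sigma)(t)\le\tau_n(x)$ implies that there is $y\in P(m)$ with $t\le\tau_m(y)$ and $P(\sigma)(y)\le x$,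 and $\tau_n(x)\le Q(\sigma)(t)$ implies that there is $y\in P(m)$ with $x\le P(\sigma)(y)$ and $\tau_m(y)\le t$. For an ind-object $X$ of $\mathbf C$ (regarded as a presheaf of sets) and a natural transformation $x\colon X\to S$ (a *type*), $(X,x)$ is an *$\omega$-saturated model* of $S$ if for all $\sigma\colon n\to m$ in $\mathbf C$, $t\in S(m)$ and $p\in X(n)$ with $S(\sigma)(t)\le x_n(p)$ there is $q\in X(m)$ with $t\le x_m(q)$ and $X(\sigma)(q)=p$. $\mathrm{Mod}_\omega(S)$ is the category of $\omega$-saturated models of $S$, a morphism $(X,x)\to(Y,y)$ being a morphism $f\colon X\to Y$ of ind-objects with $x\le y\circ f$ pointwise. For a diagram $F\colon\mathbf I\to\mathrm{Ind}(\mathbf C)$, let $\tilde F\colon\mathbf C^{\mathrm{op}}\to\mathbf{Poset}$ be its oplax colimit: $\tilde F(n)$ is the poset associated with the preorder of pairs $(i,p)$, $i\in\mathbf I$, $p\in F(i)(n)$, where $(i,p)\le(j,q)$ iff $F(f)(p)=q$ for some $f\colon i\to j$. A diagram $G\colon\mathbf I\to\mathrm{Mod}_\omega(S)$, $i\mapsto(X_i,x_i)$,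 with underlying diagram $F$ of ind-objects, induces a natural transformation $\tilde F\to S$, $(i,p)\mapsto x_i(p)$; $G$ is an *$\omega$-saturated Kripke model* of $S$ if this is an intuitionistic morphism of polyadic posets. *Theorem.* Let $S$ be a polyadic compact ordered space over $\mathbf C$. Then the identity diagram $\mathrm{Mod}_\omega(S)\to\mathrm{Mod}_\omega(S)$ is an $\omega$-saturated Kripke model of $S$. In explicit terms, for every $\omega$-saturated model $(X,x)$ of $S$: 1. (Implication) for all $n\in\mathbf C$, $p\in X(n)$ and $s\in S(n)$ with $x_n(p)\le s$, there is a morphism $f\colon(X,x)\to(Y,y)$ in $\mathrm{Mod}_\omega(S)$ with $y_n(f(p))=s$; 2. (Universal quantification) for all $\sigma\colon n\to m$ in $\mathbf C$, $p\in X(n)$ and $t\in S(m)$ with $x_n(p)\le S(\sigma)(t)$, there are a morphism $f\colon(X,x)\to(Y,y)$ in $\mathrm{Mod}_\omega(S)$ and $q\in Y(m)$ with $Y(\sigma)(q)=f(p)$ and $y_m(q)\le t$. Moreover this Kripke model is complete: for every $n\in\mathbf C$ and $s\in S(n)$ there are an $\omega$-saturated model $(X,x)$ of $S$ and $p\in X(n)$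 with $x_n(p)=s$. -/

import Mathlib

open CategoryTheory CategoryTheory.Limits Opposite

universe w₁ w₂ w v u

/-! ### Ordered structures: boundedness and interpolation -/

/-- A function between ordered sets is *bounded* if the direct image of every up-set is an
up-set. (It is applied to order-preserving functions only.) -/
def BoundedMap {A : Type*} {B : Type*} [Preorder A] [Preorder B] (f : A → B) : Prop :=
  ∀ U : Set A, IsUpperSet U → IsUpperSet (f '' U)

/-- The *interpolation property* of the lax square `u ∘ f ≤ v ∘ g` with `f : A → B`, `g : A → C`,
`u : B → D`, `v : C → D`: whenever `u b ≤ v c`, there is an interpolant `a` with `b ≤ f a` and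
`g a ≤ c`. -/
def HasInterpolation {A : Type*} {B : Type*} {C : Type*} {D : Type*}
    [Preorder B] [Preorder C] [Preorder D]
    (f : A → B) (g : A → C) (u : B → D) (v : C → D) : Prop :=
  ∀ (b : B) (c : C), u b ≤ v c → ∃ a : A, b ≤ f a ∧ g a ≤ c

/-! ### Compact ordered spaces -/

/-- The category of compact ordered spaces: compact topological spaces with a partial order that
is closed as a subset of the square. -/
structure KOrd where
  /-- The underlying set. -/
  carrier : Type w
  [top : TopologicalSpace carrier]
  [ord : PartialOrder carrier]
  [compact : CompactSpace carrier]
  [closed : OrderClosedTopology carrier]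

namespace KOrd

instance : CoeSort KOrd.{w} (Type w) := ⟨KOrd.carrier⟩

attribute [instance] KOrd.top KOrd.ord KOrd.compact KOrd.closed

/-- A morphism of compact ordered spaces: a continuous order-preserving function. -/
@[ext]
structure Hom (X Y : KOrd.{w}) where
  /-- The underlying continuous order-preserving function. -/
  hom : X →Co Y

instance : Category KOrd.{w} where
  Hom X Y := Hom X Y
  id X := ⟨ContinuousOrderHom.id X⟩
  comp f g := ⟨g.hom.comp f.hom⟩

instance : ConcreteCategory KOrd.{w} (fun X Y => X →Co Y) where
  hom := Hom.hom
  ofHom := Hom.mk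

/-- The forgetful functor from compact ordered spaces to posets. -/
def toPartOrd : KOrd.{w} ⥤ PartOrd.{w} where
  obj X := PartOrd.of X
  map f := PartOrd.ofHom (Hom.hom f).toOrderHom

end KOrd

/-! ### Polyadic spaces and polyadic posets -/

section Polyadic

variable {C : Type u} [Category.{v} C]

/-- A presheaf of posets is a *polyadic poset* if it sends every morphism to a bounded map and
every pushout square to a square with the interpolation property. (Pushout squares are symmetric,
so the choice of orientation of the square is immaterial.) -/
structure IsPolyadicPoset (P : Cᵒᵖ ⥤ PartOrd.{w}) : Prop where
  interpolation : ∀ {a b c d : C} {f : a ⟶ b} {g : a ⟶ c} {i : b ⟶ d} {j : c ⟶ d},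
    IsPushout f g i j →
      HasInterpolation (P.map i.op) (P.map j.op) (P.map f.op) (P.map g.op)
  bounded : ∀ {n m : C} (σ : n ⟶ m), BoundedMap (P.map σ.op)

/-- A presheaf of compact ordered spaces is a *polyadic compact ordered space* if it sends every
pushout square to a square with the interpolation property and every morphism to a bounded map. -/
structure IsPolyadicSpace (S : Cᵒᵖ ⥤ KOrd.{w}) : Prop where
  interpolation : ∀ {a b c d : C} {f : a ⟶ b} {g : a ⟶ c} {i : b ⟶ d} {j : c ⟶ d},
    IsPushout f g i j →
      HasInterpolation (S.map i.op) (S.map j.op) (S.map f.op) (S.map g.op)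
  bounded : ∀ {n m : C} (σ : n ⟶ m), BoundedMap (S.map σ.op)

/-- A natural transformation between presheaves of posets (possibly in different universes). -/
structure PosetPresheafHom (P : Cᵒᵖ ⥤ PartOrd.{w₁}) (Q : Cᵒᵖ ⥤ PartOrd.{w₂}) where
  /-- The components. -/
  app : ∀ n : C, P.obj (op n) →o Q.obj (op n)
  naturality : ∀ {n m : C} (σ : n ⟶ m) (x : P.obj (op m)),
    app n (P.map σ.op x) = Q.map σ.op (app m x)

/-- A natural transformation is an *intuitionistic morphism* if its components are bounded and its
naturality squares have the interpolation property in both directions. -/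
structure PosetPresheafHom.IsIntuitionistic {P : Cᵒᵖ ⥤ PartOrd.{w₁}} {Q : Cᵒᵖ ⥤ PartOrd.{w₂}}
    (τ : PosetPresheafHom P Q) : Prop where
  bounded : ∀ n : C, BoundedMap (τ.app n)
  interpolation_le : ∀ {n m : C} (σ : n ⟶ m),
    HasInterpolation (τ.app m) (P.map σ.op) (Q.map σ.op) (τ.app n)
  interpolation_ge : ∀ {n m : C} (σ : n ⟶ m),
    HasInterpolation (P.map σ.op) (τ.app m) (τ.app n) (Q.map σ.op)

/-! ### Types and `ω`-saturated models -/

/-- The set `X(n)` of `n`-points of an ind-object `X`, that is, of morphisms `n ⟶ X`. -/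
abbrev Pts (X : Ind C) (n : C) : Type v := ((Ind.inclusion C).obj X).obj (op n)

/-- The restriction `X(m) → X(n)` of points along `σ : n ⟶ m`. -/
noncomputable abbrev Pts.restr {X : Ind C} {n m : C} (σ : n ⟶ m) (x : Pts X m) : Pts X n :=
  ((Ind.inclusion C).obj X).map σ.op x

/-- The action `X(n) → Y(n)` of a morphism of ind-objects on `n`-points. -/
noncomputable abbrev Pts.push {X Y : Ind C} (f : X ⟶ Y) {n : C} (x : Pts X n) : Pts Y n :=
  ((Ind.inclusion C).map f).app (op n) x

/-- A *type* of `S`: an ind-object `X` with a natural transformation `X ⟶ S`. -/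
structure SType (S : Cᵒᵖ ⥤ KOrd.{v}) where
  /-- The underlying ind-object. -/
  ind : Ind C
  /-- The natural transformation to `S`. -/
  trans : (Ind.inclusion C).obj ind ⟶ S ⋙ forget KOrd.{v}

namespace SType

variable {S : Cᵒᵖ ⥤ KOrd.{v}}

/-- The value in `S(n)` (the "`n`-type") of an `n`-point of the underlying ind-object. -/
def val (X : SType S) {n : C} (x : Pts X.ind n) : S.obj (op n) := X.trans.app (op n) x

/-- A morphism of types `X ⟶ Y` is a morphism of the underlying ind-objects such that
`X ⟶ S` is below `X ⟶ Y ⟶ S`. -/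
@[ext]
structure Hom (X Y : SType S) where
  /-- The underlying morphism of ind-objects. -/
  hom : X.ind ⟶ Y.ind
  le : ∀ {n : C} (x : Pts X.ind n), X.val x ≤ Y.val (Pts.push hom x)

/-- The category `Tp(S)` of types of `S`. -/
noncomputable instance : Category (SType S) where
  Hom X Y := Hom X Y
  id X := ⟨𝟙 X.ind, fun x => by simp [Pts.push]⟩
  comp f g := ⟨f.hom ≫ g.hom, fun x => (f.le x).trans <| by
    simpa [Pts.push] using g.le (Pts.push f.hom x)⟩

variable (S) in
/-- The functor sending a type to its underlying ind-object. -/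
noncomputable def toInd : SType S ⥤ Ind C where
  obj X := X.ind
  map f := Hom.hom f

/-- A type `X ⟶ S` is an *`ω`-saturated model* if all its naturality squares have the interpolation
property; as the order on the sets `X(n)` is discrete, this says that for all `t ∈ S(m)` and
`x ∈ X(n)` with `S(σ)(t) ≤ x`, there is `y ∈ X(m)` above `t` that restricts to `x`. -/
def IsOmegaSaturated (X : SType S) : Prop :=
  ∀ {n m : C} (σ : n ⟶ m) (t : S.obj (op m)) (x : Pts X.ind n), S.map σ.op t ≤ X.val x →
    ∃ y : Pts X.ind m, t ≤ X.val y ∧ Pts.restr σ y = x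

end SType

/-- `Mod_ω(S)`: the full subcategory of the category of types on the `ω`-saturated models. -/
abbrev ModOmega (S : Cᵒᵖ ⥤ KOrd.{v}) : Type (max u (v + 1)) :=
  ObjectProperty.FullSubcategory (fun X : SType S => X.IsOmegaSaturated)

/-- The forgetful functor from `ω`-saturated models to ind-objects. -/
noncomputable def ModOmega.toInd (S : Cᵒᵖ ⥤ KOrd.{v}) : ModOmega S ⥤ Ind C :=
  ObjectProperty.ι _ ⋙ SType.toInd S

/-! ### Oplax colimits of ind-objects and Kripke models -/

section Kripke

variable {I : Type w₁} [Category.{w₂} I]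

/-- Pairs `(i, x)` with `x` an `n`-point of `F(i)`. -/
structure OplaxPt (F : I ⥤ Ind C) (n : C) where
  /-- The index. -/
  idx : I
  /-- The point. -/
  pt : Pts (F.obj idx) n

/-- `(i, x) ≤ (j, y)` when there is `f : i ⟶ j` such that `F(f)(x) = y`. -/
instance (F : I ⥤ Ind C) (n : C) : Preorder (OplaxPt F n) where
  le p q := ∃ f : p.idx ⟶ q.idx, Pts.push (F.map f) p.pt = q.pt
  le_refl p := ⟨𝟙 _, by simp [Pts.push]⟩
  le_trans := by
    rintro p q r ⟨f, hf⟩ ⟨g, hg⟩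
    exact ⟨f ≫ g, by simpa [Pts.push, ← hf] using hg⟩

/-- Restriction of pairs along `σ : n ⟶ m`. -/
noncomputable def OplaxPt.restr (F : I ⥤ Ind C) {n m : C} (σ : n ⟶ m) :
    OplaxPt F m →o OplaxPt F n where
  toFun p := ⟨p.idx, Pts.restr σ p.pt⟩
  monotone' := by
    rintro p q ⟨f, hf⟩
    refine ⟨f, ?_⟩
    have h := NatTrans.naturality_apply ((Ind.inclusion C).map (F.map f)) σ.op p.pt
    exact h.trans (congrArg (Pts.restr σ) hf)

/-- The oplax colimit `F̃` in presheaves of posets of a diagram `F` of ind-objects (regarded as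
presheaves of discrete posets). Its value at `n` is the poset of pairs `(i, x)`; as `I` is a
category and not only a poset, pairs that lie below each other have to be identified. -/
noncomputable def oplaxColimit (F : I ⥤ Ind C) : Cᵒᵖ ⥤ PartOrd.{max w₁ v} where
  obj n := PartOrd.of (Antisymmetrization (OplaxPt F n.unop) (· ≤ ·))
  map σ := PartOrd.ofHom (OplaxPt.restr F σ.unop).antisymmetrization
  map_id n := by
    ext x
    induction x using Antisymmetrization.ind with
    | _ p => simp [OplaxPt.restr, Pts.restr]
  map_comp σ τ := by
    ext x
    induction x using Antisymmetrization.ind with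
    | _ p =>
      refine congrArg (toAntisymmetrization (α := OplaxPt F _) (· ≤ ·)) ?_
      simp [OplaxPt.restr, Pts.restr]

variable {S : Cᵒᵖ ⥤ KOrd.{v}}

/-- The diagram of ind-objects underlying a diagram of `ω`-saturated models. -/
noncomputable abbrev underlyingDiagram (G : I ⥤ ModOmega S) : I ⥤ Ind C := G ⋙ ModOmega.toInd S

/-- A diagram `G` of `ω`-saturated models is an oplax cocone from the underlying diagram of
ind-objects to `S`; this is the corresponding natural transformation from the oplax colimit
to `S`, which sends `(i, x)` to the value of `x` in the model `G(i)`. -/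
noncomputable def kripkeHom (G : I ⥤ ModOmega S) :
    PosetPresheafHom (oplaxColimit (underlyingDiagram G)) (S ⋙ KOrd.toPartOrd) where
  app n :=
    { toFun := Quotient.lift
        (fun p : OplaxPt (underlyingDiagram G) n => ((G.obj p.idx).obj.val p.pt : S.obj (op n)))
        (by
          rintro p q ⟨⟨f, hf⟩, ⟨g, hg⟩⟩
          apply le_antisymm
          · exact hf ▸ SType.Hom.le (G.map f).hom p.pt
          · exact hg ▸ SType.Hom.le (G.map g).hom q.pt)
      monotone' := by
        intro a b
        induction a using Antisymmetrization.ind with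
        | _ p =>
          induction b using Antisymmetrization.ind with
          | _ q =>
            rintro ⟨f, hf⟩
            exact (SType.Hom.le (G.map f).hom p.pt).trans_eq
              (congrArg (G.obj q.idx).obj.val hf) }
  naturality σ x := by
    induction x using Antisymmetrization.ind with
    | _ p => exact NatTrans.naturality_apply (G.obj p.idx).obj.trans σ.op p.pt

/-- A diagram `G` of `ω`-saturated models of `S` is an *`ω`-saturated Kripke model* of `S` if the
corresponding natural transformation from the oplax colimit to `S` is an intuitionistic morphism
of polyadic posets. -/
structure IsOmegaSaturatedKripkeModel (G : I ⥤ ModOmega S) : Prop where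
  source : IsPolyadicPoset (oplaxColimit (underlyingDiagram G))
  target : IsPolyadicPoset (S ⋙ KOrd.toPartOrd)
  intuitionistic : (kripkeHom G).IsIntuitionistic

/-- The Kripke condition for implication. -/
def KripkeImplication (G : I ⥤ ModOmega S) : Prop :=
  ∀ (i : I) {n : C} (x : Pts (G.obj i).obj.ind n) (s : S.obj (op n)),
    (G.obj i).obj.val x ≤ s →
      ∃ (j : I) (f : i ⟶ j), (G.obj j).obj.val (Pts.push (G.map f).hom.hom x) = s

/-- The Kripke condition for universal quantification. -/
def KripkeUniversal (G : I ⥤ ModOmega S) : Prop :=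
  ∀ (i : I) {n m : C} (σ : n ⟶ m) (x : Pts (G.obj i).obj.ind n) (t : S.obj (op m)),
    (G.obj i).obj.val x ≤ S.map σ.op t →
      ∃ (j : I) (f : i ⟶ j) (y : Pts (G.obj j).obj.ind m),
        Pts.restr σ y = Pts.push (G.map f).hom.hom x ∧ (G.obj j).obj.val y ≤ t

end Kripke

end Polyadic

/-!
The whole theorem rests on one way of extending a type. Let `X ⟶ S` be a type, `p` an `n`-point of
the ind-object `X` and `σ : n ⟶ m`. If `X` is the filtered colimit of objects `c j` under `n`, then
the pushout `Z` of `X` along `σ` is the filtered colimit of the pushouts `d j` of `c j` along `σ`,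
so a type on `Z` is a compatible family of elements of the compact Hausdorff spaces `S (d j)`.
If closed conditions on such families, stable under restriction, can be satisfied at each `j`
separately, then they can be satisfied simultaneously, as a cofiltered limit of nonempty compact
Hausdorff spaces is nonempty (`SType.exists_extension`). At each `j` they are satisfied by
interpolation for pushout squares and by boundedness. There are three instances:

* if `S(σ)(t) ≤ x(p)`, a point above `t` and restricting to `p` can be adjoined without
  changing the values of the points of `X` (`SType.exists_exact_extension`);
* if `x(p) ≤ S(σ)(t)`, a point below `t` and restricting to `p` can be adjoined while
  the values of the points of `X` increase (`SType.exists_extension_le`);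
* if `x(p) ≤ s`, the values of the points of `X` can be increased such that the value of `p`
  becomes `s` (`SType.exists_extension_eq`).

The first instance yields `ω`-saturated models. As it preserves values, it can be iterated in the
category of types and exact morphisms, which has filtered colimits. As `C` is essentially small,
the saturation conditions on `X` form a small set; a transfinite iteration meets all of them in
one extension (`exists_hom_forall`, `ExactType.exists_realizes_all`). This extension has new
points, but after `ω` repetitions all conditions are met, as the points of the colimit come from
finite stages. So every type has an `ω`-saturated extension with the same values
(`SType.exists_modOmega`). Applied to the outcomes of the other two instances, this gives the
Kripke conditions for implication and universal quantification; applied to representable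
ind-objects, it gives completeness. These conditions together with saturation say that the
comparison from the oplax colimit to `S` is intuitionistic; that the oplax colimit is polyadic
holds for all diagrams of ind-objects, as these send pushouts to pullbacks.
-/

/-! ### Points of ind-objects and filtered colimits -/

section Presentations

variable {C : Type u} [Category.{v} C]

theorem Pts.restr_push {X Y : Ind C} (f : X ⟶ Y) {n m : C} (σ : n ⟶ m) (p : Pts X m) :
    Pts.restr σ (Pts.push f p) = Pts.push f (Pts.restr σ p) :=
  (NatTrans.naturality_apply ((Ind.inclusion C).map f) σ.op p).symm

theorem Pts.push_comp {X Y Z : Ind C} (f : X ⟶ Y) (g : Y ⟶ Z) {n : C} (p : Pts X n) :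
    Pts.push (f ≫ g) p = Pts.push g (Pts.push f p) := by
  simp [Pts.push]

theorem Pts.restr_comp {X : Ind C} {a b c : C} (f : a ⟶ b) (g : b ⟶ c) (p : Pts X c) :
    Pts.restr (f ≫ g) p = Pts.restr f (Pts.restr g p) := by
  simp [Pts.restr]

/-- The points `r j` of the ind-object `X` exhibit it as the colimit, in presheaves, of the
representable presheaves of the diagram `E`. Only those parts of the universal property are recorded
that are used: the `r j` form a cocone, they generate the points of `X`, and every cocone
factors through them. -/
structure IsIndColimit (X : Ind C) {J : Type v} [SmallCategory J] (E : J ⥤ C)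
    (r : ∀ j, Pts X (E.obj j)) : Prop where
  restr_map : ∀ {i j : J} (f : i ⟶ j), Pts.restr (E.map f) (r j) = r i
  exists_restr : ∀ {c : C} (p : Pts X c), ∃ (j : J) (a : c ⟶ E.obj j), Pts.restr a (r j) = p
  exists_desc : ∀ (B : Cᵒᵖ ⥤ Type v) (b : ∀ j, B.obj (op (E.obj j))),
    (∀ {i j : J} (f : i ⟶ j), B.map (E.map f).op (b j) = b i) →
      ∃ φ : (Ind.inclusion C).obj X ⟶ B, ∀ j, φ.app _ (r j) = b j

theorem isIndColimit_of_isColimit {X : Ind C} {J : Type v} [SmallCategory J] {E : J ⥤ C}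
    (ι : E ⋙ yoneda ⟶ (Functor.const J).obj ((Ind.inclusion C).obj X))
    (hι : IsColimit (Cocone.mk _ ι)) :
    IsIndColimit X E (fun j => (ι.app j).app _ (𝟙 (E.obj j))) := by
  have key (j : J) {c : C} (a : c ⟶ E.obj j) :
      Pts.restr a (X := X) ((ι.app j).app _ (𝟙 (E.obj j))) = (ι.app j).app (op c) a :=
    (NatTrans.naturality_apply (ι.app j) a.op (𝟙 (E.obj j))).symm.trans
      (congrArg ((ι.app j).app (op c)) (Category.comp_id a))
  refine ⟨fun {i j} f => ?_, fun {c} p => ?_, fun B b hb => ?_⟩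
  · rw [key]
    have := ConcreteCategory.congr_hom (congr_app (ι.naturality f) _) (𝟙 (E.obj i))
    refine Eq.trans (congrArg ((ι.app j).app _) (Category.id_comp _).symm) (this.trans ?_)
    rfl
  · obtain ⟨j, a, ha⟩ := Types.jointly_surjective _
      (isColimitOfPreserves ((evaluation _ _).obj (op c)) hι) p
    exact ⟨j, a, (key j a).trans ha⟩
  · let s : Cocone (E ⋙ yoneda) :=
      { pt := B
        ι := { app j := yonedaEquiv.symm (b j)
               naturality i j f := by
                 apply yonedaEquiv.injective
                 simp [yonedaEquiv_symm_naturality_left, hb] } }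
    refine ⟨hι.desc s, fun j => ?_⟩
    have := ConcreteCategory.congr_hom (congr_app (hι.fac s j) _) (𝟙 (E.obj j))
    refine this.trans ?_
    exact yonedaEquiv.apply_symm_apply (b j)

/-- An ind-object under `n` is a filtered colimit of objects of `C` under `n`. -/
theorem exists_isIndColimit_under (X : Ind C) {n : C} (p : Pts X n) :
    ∃ (J : Type v) (_ : SmallCategory J) (_ : IsFiltered J) (E : J ⥤ C)
      (r : ∀ j, Pts X (E.obj j)) (u : ∀ j, n ⟶ E.obj j), IsIndColimit X E r ∧
        (∀ {i j : J} (f : i ⟶ j), u i ≫ E.map f = u j) ∧ ∀ j, Pts.restr (u j) (r j) = p := by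
  let P := X.isIndObject_inclusion_obj.presentation
  have hP := isIndColimit_of_isColimit P.ι P.isColimit
  obtain ⟨i, a, ha⟩ := hP.exists_restr p
  have h := isIndColimit_of_isColimit (X := X) (E := Under.forget i ⋙ P.F)
    (P.cocone.whisker (Under.forget i)).ι
    ((Functor.Final.isColimitWhiskerEquiv (Under.forget i) P.cocone).symm P.coconeIsColimit)
  refine ⟨Under i, inferInstance, inferInstance, _, _, fun j => a ≫ P.F.map j.hom, h, ?_, ?_⟩
  · intro j k f
    simp [← Functor.map_comp]
  · intro j
    exact (Pts.restr_comp a (P.F.map j.hom) _).trans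
      ((congrArg (Pts.restr a) (hP.restr_map j.hom)).trans ha)

theorem exists_isIndColimit {J : Type v} [SmallCategory J] [IsFiltered J] (E : J ⥤ C) :
    ∃ (Z : Ind C) (r : ∀ j, Pts Z (E.obj j)), IsIndColimit Z E r := by
  have e : (E ⋙ Ind.yoneda) ⋙ Ind.inclusion C ≅ E ⋙ yoneda :=
    Functor.associator _ _ _ ≪≫ Functor.isoWhiskerLeft E Ind.yonedaCompInclusion
  have h := isColimitOfPreserves (Ind.inclusion C) (colimit.isColimit (E ⋙ Ind.yoneda))
  exact ⟨_, _, isIndColimit_of_isColimit _ ((IsColimit.precomposeInvEquiv e _).symm h)⟩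

/-- Pushouts along `σ` of a diagram of objects under `n`, made into a diagram. -/
theorem exists_pushout_functor [HasPushouts C] {J : Type*} [Category J] (E : J ⥤ C) {n m : C}
    (u : ∀ j, n ⟶ E.obj j) (hu : ∀ {i j : J} (f : i ⟶ j), u i ≫ E.map f = u j) (σ : n ⟶ m) :
    ∃ (F : J ⥤ C) (inl : E ⟶ F) (inr : ∀ j, m ⟶ F.obj j),
      (∀ {i j : J} (f : i ⟶ j), inr i ≫ F.map f = inr j) ∧
        ∀ j, IsPushout (u j) σ (inl.app j) (inr j) := by
  let t {i j : J} (f : i ⟶ j) : pushout (u i) σ ⟶ pushout (u j) σ :=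
    pushout.desc (E.map f ≫ pushout.inl _ _) (pushout.inr _ _) (by
      rw [← pushout.condition, ← Category.assoc, hu])
  have ht_l {i j : J} (f : i ⟶ j) : pushout.inl (u i) σ ≫ t f = E.map f ≫ pushout.inl _ _ :=
    pushout.inl_desc _ _ _
  have ht_r {i j : J} (f : i ⟶ j) : pushout.inr (u i) σ ≫ t f = pushout.inr _ _ :=
    pushout.inr_desc _ _ _
  let F : J ⥤ C :=
    { obj j := pushout (u j) σ
      map f := t f
      map_id j := by apply pushout.hom_ext <;> simp [ht_l, ht_r]
      map_comp f g := by
        apply pushout.hom_ext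
        · rw [ht_l, ← Category.assoc, ht_l, Category.assoc, ht_l, Functor.map_comp, Category.assoc]
        · rw [ht_r, ← Category.assoc, ht_r, ht_r] }
  exact ⟨F, { app j := pushout.inl (u j) σ, naturality _ _ f := (ht_l f).symm },
    fun j => pushout.inr (u j) σ, ht_r, fun j => IsPushout.of_hasPushout _ _⟩

end Presentations

/-! ### Extension of types by compactness -/

namespace SType
variable {C : Type u} [Category.{v} C] {S : Cᵒᵖ ⥤ KOrd.{v}}

theorem val_restr (X : SType S) {n m : C} (σ : n ⟶ m) (p : Pts X.ind m) :
    X.val (Pts.restr σ p) = S.map σ.op (X.val p) :=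
  NatTrans.naturality_apply X.trans σ.op p

theorem map_comp_apply (S : Cᵒᵖ ⥤ KOrd.{v}) {a b c : C} (f : a ⟶ b) (g : b ⟶ c)
    (x : S.obj (op c)) :
    S.map (f ≫ g).op x = S.map f.op (S.map g.op x) := by
  simp

theorem continuous_map (S : Cᵒᵖ ⥤ KOrd.{v}) {a b : C} (f : a ⟶ b) : Continuous (S.map f.op) :=
  (ConcreteCategory.hom (S.map f.op)).continuous_toFun

theorem monotone_map (S : Cᵒᵖ ⥤ KOrd.{v}) {a b : C} (f : a ⟶ b) : Monotone (S.map f.op) :=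
  (ConcreteCategory.hom (S.map f.op)).monotone'

/-- An inverse system of nonempty closed subsets has a compatible family of elements. -/
theorem exists_compatible {J : Type v} [SmallCategory J] [IsFiltered J] (F : J ⥤ C)
    (K : ∀ j, Set (S.obj (op (F.obj j)))) (hne : ∀ j, (K j).Nonempty)
    (hcl : ∀ j, IsClosed (K j))
    (hmap : ∀ {i j} (f : i ⟶ j), ∀ z ∈ K j, S.map (F.map f).op z ∈ K i) :
    ∃ z : ∀ j, S.obj (op (F.obj j)), (∀ j, z j ∈ K j) ∧
      ∀ {i j} (f : i ⟶ j), S.map (F.map f).op (z j) = z i := by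
  let T : Jᵒᵖ ⥤ TopCat.{v} :=
    { obj j := TopCat.of (K j.unop)
      map f := TopCat.ofHom ⟨fun z => ⟨S.map (F.map f.unop).op z.1, hmap f.unop _ z.2⟩,
        ((continuous_map S _).comp continuous_subtype_val).subtype_mk _⟩
      map_id j := by ext z; simp
      map_comp f g := by ext z; simp }
  have (j : Jᵒᵖ) : Nonempty (T.obj j) := (hne j.unop).to_subtype
  have (j : Jᵒᵖ) : CompactSpace (T.obj j) := isCompact_iff_compactSpace.1 (hcl j.unop).isCompact
  have (j : Jᵒᵖ) : T2Space (T.obj j) := inferInstanceAs (T2Space (K j.unop))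
  obtain ⟨z, hz⟩ := TopCat.nonempty_limitCone_of_compact_t2_cofiltered_system T
  exact ⟨fun j => (z (op j)).1, fun j => (z (op j)).2, fun f => congrArg Subtype.val (hz f.op)⟩

/-- Extension of a type along the pushout of `X` along `σ`, by compactness. The relation `L`
compares the old and the new value of a point of `X`; it will be equality or the order. The value of
the new point is required to lie in the closed set `M`. If this can be achieved for objects `c`
of `C` in place of `X`, then it can be achieved for `X`. -/
theorem exists_extension [HasPushouts C] (X : SType S) {n m : C} (p : Pts X.ind n) (σ : n ⟶ m)
    (L : ∀ c : C, S.obj (op c) → S.obj (op c) → Prop)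
    (L_closed : ∀ c x, IsClosed {z | L c x z})
    (L_map : ∀ {c d : C} (f : c ⟶ d) (x z : S.obj (op d)), L d x z →
      L c (S.map f.op x) (S.map f.op z))
    (M : Set (S.obj (op m))) (hM : IsClosed M)
    (ext : ∀ {c d : C} {u : n ⟶ c} {i : c ⟶ d} {j : m ⟶ d}, IsPushout u σ i j →
      ∀ x : S.obj (op c), S.map u.op x = X.val p →
        ∃ z : S.obj (op d), L c x (S.map i.op z) ∧ S.map j.op z ∈ M) :
    ∃ (Z : SType S) (f : X.ind ⟶ Z.ind) (q : Pts Z.ind m),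
      Pts.restr σ q = Pts.push f p ∧
      (∀ {c : C} (r : Pts X.ind c), L c (X.val r) (Z.val (Pts.push f r))) ∧ Z.val q ∈ M := by
  obtain ⟨J, _, _, E, r, u, hE, hu, hp⟩ := exists_isIndColimit_under X.ind p
  obtain ⟨F, inl, inr, hinr, hpo⟩ := exists_pushout_functor E u hu σ
  obtain ⟨Z, q, hF⟩ := exists_isIndColimit F
  obtain ⟨z, hzK, hz⟩ := exists_compatible (S := S) F
    (fun j => {z | L _ (X.val (r j)) (S.map (inl.app j).op z) ∧ S.map (inr j).op z ∈ M})
    (fun j => ext (hpo j) _ (by rw [← val_restr, hp]))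
    (fun j => ((L_closed _ _).preimage (continuous_map S _)).inter
      (hM.preimage (continuous_map S _))) (by
      rintro i j f z ⟨h1, h2⟩
      refine ⟨?_, ?_⟩
      · rw [← map_comp_apply, ← inl.naturality, map_comp_apply, ← hE.restr_map f, val_restr]
        exact L_map _ _ _ h1
      · rwa [← map_comp_apply, hinr])
  obtain ⟨φ, hφ⟩ := hF.exists_desc (S ⋙ forget KOrd) z hz
  obtain ⟨ψ, hψ⟩ := hE.exists_desc ((Ind.inclusion C).obj Z)
    (fun j => Pts.restr (inl.app j) (q j)) (by
      intro i j f
      change Pts.restr _ (Pts.restr _ _) = _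
      rw [← Pts.restr_comp, inl.naturality, Pts.restr_comp, hF.restr_map])
  let f : X.ind ⟶ Z := Ind.inclusion.fullyFaithful.preimage ψ
  have hf (j : J) : Pts.push f (r j) = Pts.restr (inl.app j) (q j) := by
    rw [← hψ]
    simp [Pts.push, f]
  let Z' : SType S := ⟨Z, φ⟩
  have hZ' (j : J) : Z'.val (q j) = z j := hφ j
  obtain ⟨j₀⟩ : Nonempty J := IsFiltered.nonempty
  refine ⟨Z', f, Pts.restr (inr j₀) (q j₀), ?_, fun {c} s => ?_, ?_⟩
  · rw [← Pts.restr_comp, ← (hpo j₀).w, Pts.restr_comp, ← hf, Pts.restr_push, hp]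
  · obtain ⟨j, a, rfl⟩ := hE.exists_restr s
    rw [← Pts.restr_push, val_restr, val_restr, hf, val_restr, hZ']
    exact L_map _ _ _ (hzK j).1
  · rw [val_restr, hZ']
    exact (hzK j₀).2

end SType

theorem BoundedMap.exists_ge {A B : Type*} [Preorder A] [Preorder B] {f : A → B}
    (hf : BoundedMap f) {a : A} {b : B} (h : f a ≤ b) : ∃ a', a ≤ a' ∧ f a' = b :=
  hf _ (isUpperSet_Ici a) h ⟨a, Set.mem_Ici.2 le_rfl, rfl⟩

theorem boundedMap_of_exists_ge {A B : Type*} [Preorder A] [Preorder B] {f : A → B}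
    (h : ∀ a b, f a ≤ b → ∃ a', a ≤ a' ∧ f a' = b) : BoundedMap f := by
  rintro U hU _ b hb ⟨a, ha, rfl⟩
  obtain ⟨a', haa', rfl⟩ := h a b hb
  exact ⟨a', hU haa' ha, rfl⟩

namespace SType

variable {C : Type u} [Category.{v} C] [HasPushouts C] {S : Cᵒᵖ ⥤ KOrd.{v}}

/-- A point above `t` can be adjoined to `X` over `p` without changing values. Interpolation only
gives a `z` with `S(i)(z) ≤ x`; boundedness then replaces it by a larger one with equality. -/
theorem exists_exact_extension (hS : IsPolyadicSpace S) (X : SType S) {n m : C} (σ : n ⟶ m)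
    (t : S.obj (op m)) (p : Pts X.ind n) (h : S.map σ.op t ≤ X.val p) :
    ∃ (Z : SType S) (f : X.ind ⟶ Z.ind) (q : Pts Z.ind m),
      (∀ {c : C} (r : Pts X.ind c), Z.val (Pts.push f r) = X.val r) ∧
      t ≤ Z.val q ∧ Pts.restr σ q = Pts.push f p := by
  obtain ⟨Z, f, q, hq, hf, ht⟩ := X.exists_extension p σ (fun c x z => z = x)
    (fun c x => isClosed_singleton) (by rintro c d f x _ rfl; rfl) (Set.Ici t) isClosed_Ici (by
      intro c d u i j hpo x hx
      obtain ⟨z, hz, hz'⟩ := hS.interpolation hpo.flip t x (h.trans_eq hx.symm)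
      obtain ⟨z', hzz', rfl⟩ := (hS.bounded i).exists_ge hz'
      exact ⟨z', rfl, hz.trans (monotone_map S j hzz')⟩)
  exact ⟨Z, f, q, hf, ht, hq⟩

/-- A point below `t` can be adjoined to `X` over `p` while values increase. -/
theorem exists_extension_le (hS : IsPolyadicSpace S) (X : SType S) {n m : C} (σ : n ⟶ m)
    (t : S.obj (op m)) (p : Pts X.ind n) (h : X.val p ≤ S.map σ.op t) :
    ∃ (Z : SType S) (f : X ⟶ Z) (q : Pts Z.ind m),
      Pts.restr σ q = Pts.push f.hom p ∧ Z.val q ≤ t := by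
  obtain ⟨Z, f, q, hq, hf, ht⟩ := X.exists_extension p σ (fun c x z => x ≤ z)
    (fun c x => isClosed_Ici) (fun f x z hxz => monotone_map S f hxz) (Set.Iic t) isClosed_Iic (by
      intro c d u i j hpo x hx
      obtain ⟨z, hz, hz'⟩ := hS.interpolation hpo x t (hx.trans_le h)
      exact ⟨z, hz, hz'⟩)
  exact ⟨Z, ⟨f, hf⟩, q, hq, ht⟩

/-- The value of `p` can be increased to any `s` above it. -/
theorem exists_extension_eq (hS : IsPolyadicSpace S) (X : SType S) {n : C}
    (s : S.obj (op n)) (p : Pts X.ind n) (h : X.val p ≤ s) :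
    ∃ (Z : SType S) (f : X ⟶ Z), Z.val (Pts.push f.hom p) = s := by
  obtain ⟨Z, f, q, hq, hf, ht⟩ := X.exists_extension p (𝟙 n) (fun c x z => x ≤ z)
    (fun c x => isClosed_Ici) (fun f x z hxz => monotone_map S f hxz) {s} isClosed_singleton (by
      intro c d u i j hpo x hx
      obtain ⟨x', hxx', hx'⟩ := (hS.bounded u).exists_ge (hx.trans_le h)
      -- The pushout of the identity `𝟙 n` is an isomorphism, with this inverse.
      obtain ⟨k, hk, hk'⟩ := hpo.exists_desc (𝟙 c) u (by simp)
      refine ⟨S.map k.op x', ?_, ?_⟩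
      · rw [← map_comp_apply, hk]
        simpa using hxx'
      · rw [← map_comp_apply, hk']
        exact hx')
  refine ⟨Z, ⟨f, hf⟩, ?_⟩
  rw [← hq]
  simpa [Pts.restr] using ht

end SType

/-! ### Transfinite iteration -/

section Iteration

theorem preservesColimitsOfShape_fromPUnit {D : Type*} [Category D] {J : Type*} [Category J]
    [IsConnected J] (X : D) : PreservesColimitsOfShape J (Functor.fromPUnit.{0} X) where
  preservesColimit {K} := ⟨fun {c} _ => ⟨by
    have j₀ : J := Classical.arbitrary J
    have key (s : Cocone (K ⋙ Functor.fromPUnit X)) (j : J) :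
        (show X ⟶ s.pt from s.ι.app j) = s.ι.app j₀ :=
      constant_of_preserves_morphisms (fun j => (show X ⟶ s.pt from s.ι.app j)) (fun i j f => by
        have := s.w f
        exact this.symm.trans (Category.id_comp _)) j j₀
    exact
      { desc s := (show X ⟶ s.pt from s.ι.app j₀)
        fac s j := (Category.id_comp _).trans (key s j).symm
        uniq s m hm := (Category.id_comp _).symm.trans (hm j₀) }⟩⟩

theorem hasColimitsOfShape_under {D : Type*} [Category D] {J : Type*} [Category J]
    [IsConnected J] [HasColimitsOfShape J D] (X : D) : HasColimitsOfShape J (Under X) :=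
  have := preservesColimitsOfShape_fromPUnit (J := J) X
  inferInstanceAs (HasColimitsOfShape J (Comma (Functor.fromPUnit X) (𝟭 D)))

open Cardinal in
/-- Let `P τ` be properties of objects that are preserved along morphisms and such that every object
has a morphism to one with the property `P τ`. If there are few `τ`, every object has a
morphism to one with all the properties: a chain that acquires a missing property at each
successor step cannot be longer than the number of properties. -/
theorem exists_hom_forall {D : Type*} [Category D]
    (hD : ∀ (J : Type w) [LinearOrder J] [Nonempty J], HasColimitsOfShape J D)
    {T : Type w} (P : T → D → Prop) (hP : ∀ τ {Y Z : D}, (Y ⟶ Z) → P τ Y → P τ Z)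
    (h : ∀ τ Y, ∃ Z, Nonempty (Y ⟶ Z) ∧ P τ Z) (X : D) :
    ∃ Y, Nonempty (X ⟶ Y) ∧ ∀ τ, P τ Y := by
  classical
  by_contra! hX
  -- The successor of `Y` acquires one chosen property that `Y` lacks, if there is any.
  have step (Y : D) : ∃ (Z : D) (_ : Y ⟶ Z), ∀ h : ∃ τ, ¬ P τ Y, P h.choose Z := by
    by_cases h' : ∃ τ, ¬ P τ Y
    · obtain ⟨Z, ⟨f⟩, hZ⟩ := h h'.choose Y
      exact ⟨Z, f, fun _ => hZ⟩
    · exact ⟨Y, 𝟙 Y, fun h => (h' h).elim⟩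
  choose succ toSucc hsucc using step
  let Φ : SmallObject.SuccStruct D := ⟨X, succ, toSucc⟩
  let κ : Cardinal.{w} := Order.succ (max ℵ₀ #T)
  have hκ : ℵ₀ ≤ κ := (le_max_left _ _).trans (Order.le_succ _)
  let J := κ.ord.ToType
  have : NoMaxOrder J := Cardinal.noMaxOrder hκ
  have hJ : #J = κ := mk_ord_toType κ
  have : Nonempty J := mk_ne_zero_iff.1 (by rw [hJ]; exact (aleph0_pos.trans_le hκ).ne')
  let _ : OrderBot J := WellFoundedLT.toOrderBot J
  let _ : SuccOrder J := SuccOrder.ofLinearWellFoundedLT J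
  have : HasIterationOfShape J D :=
    { hasColimitsOfShape_of_isSuccLimit j hj :=
        have : Nonempty (Set.Iio j) := ⟨⟨⊥, hj.bot_lt⟩⟩
        hD _
      hasColimitsOfShape := hD J }
  let F := Φ.iterationFunctor J
  have hF (j : J) : ∃ τ, ¬ P τ (F.obj j) := hX _ ⟨(Φ.ιIterationFunctor J).app j⟩
  have hlt {i j : J} (hij : i < j) : P (hF i).choose (F.obj j) :=
    hP _ ((Φ.iterationFunctorObjSuccIso i (not_isMax i)).inv ≫
      F.map (homOfLE (Order.succ_le_of_lt hij))) (hsucc _ (hF i))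
  -- The properties chosen at different stages differ, which bounds the length of the chain.
  have hinj : Function.Injective fun j => (hF j).choose := by
    intro i j (hij : (hF i).choose = (hF j).choose)
    by_contra hne
    rcases lt_or_gt_of_ne hne with h' | h'
    · exact (hF j).choose_spec (by rw [← hij]; exact hlt h')
    · exact (hF i).choose_spec (by rw [hij]; exact hlt h')
  have := mk_le_of_injective hinj
  rw [hJ] at this
  exact (Order.lt_succ (max ℵ₀ #T)).not_ge (this.trans (le_max_right _ _))

end Iteration

/-! ### Exact types and saturation -/

section Exact

variable {C : Type u} [Category.{v} C]

instance : HasColimitsOfShape ℕ (Ind C) :=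
  hasColimitsOfShape_of_equivalence (AsSmall.equiv (C := ℕ)).symm

instance : PreservesColimitsOfShape ℕ (Ind.inclusion C) :=
  preservesColimitsOfShape_of_equiv (AsSmall.equiv (C := ℕ)).symm _

/-- The category of types of `S` and exact morphisms, that is, morphisms of ind-objects over `S`,
which preserve the values of points instead of only increasing them. -/
abbrev ExactType (S : Cᵒᵖ ⥤ KOrd.{v}) : Type (max u (v + 1)) :=
  CostructuredArrow (Ind.inclusion C) (S ⋙ forget KOrd.{v})

namespace ExactType

variable {S : Cᵒᵖ ⥤ KOrd.{v}}

/-- An exact type, as an object of the category of types. -/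
noncomputable abbrev toSType (X : ExactType S) : SType S := ⟨X.left, X.hom⟩

theorem val_push {X Y : ExactType S} (f : X ⟶ Y) {n : C} (p : Pts X.left n) :
    Y.toSType.val (Pts.push f.left p) = X.toSType.val p :=
  ConcreteCategory.congr_hom (congr_app (CostructuredArrow.w f) (op n)) p

theorem push_comp_left {X Y Z : ExactType S} (f : X ⟶ Y) (g : Y ⟶ Z) {n : C}
    (p : Pts X.left n) : Pts.push (f ≫ g).left p = Pts.push g.left (Pts.push f.left p) :=
  Pts.push_comp f.left g.left p

theorem exists_push_colimit_ι (F : ℕ ⥤ ExactType S) {n : C} (p : Pts (colimit F).left n) :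
    ∃ (k : ℕ) (q : Pts (F.obj k).left n), Pts.push (colimit.ι F k).left q = p :=
  Types.jointly_surjective _ (isColimitOfPreserves
    (CostructuredArrow.proj _ _ ⋙ Ind.inclusion C ⋙ (evaluation _ _).obj (op n))
    (colimit.isColimit F)) p

/-- Saturation of `Y` for one instance: some point above `t` restricts to `p` along `σ`. -/
def Realizes (Y : ExactType S) {n m : C} (σ : n ⟶ m) (t : S.obj (op m)) (p : Pts Y.left n) :
    Prop :=
  ∃ q : Pts Y.left m, t ≤ Y.toSType.val q ∧ Pts.restr σ q = p

theorem Realizes.push {X Y : ExactType S} {n m : C} {σ : n ⟶ m} {t : S.obj (op m)}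
    {p : Pts X.left n} (h : X.Realizes σ t p) (f : X ⟶ Y) : Y.Realizes σ t (Pts.push f.left p) := by
  obtain ⟨q, hq, rfl⟩ := h
  exact ⟨Pts.push f.left q, hq.trans_eq (val_push f q).symm, Pts.restr_push _ _ _⟩

variable [HasPushouts C]

theorem exists_realizes (hS : IsPolyadicSpace S) (X : ExactType S) {n m : C} (σ : n ⟶ m)
    (t : S.obj (op m)) (p : Pts X.left n) (h : S.map σ.op t ≤ X.toSType.val p) :
    ∃ (Y : ExactType S) (f : X ⟶ Y), Y.Realizes σ t (Pts.push f.left p) := by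
  obtain ⟨Z, f, q, hf, ht, hq⟩ := X.toSType.exists_exact_extension hS σ t p h
  exact ⟨CostructuredArrow.mk Z.trans, CostructuredArrow.homMk f (by
    ext c r
    exact hf r), q, ht, hq⟩

/-- A small family of instances of saturation can be met in one exact extension. -/
theorem exists_realizes_family (hS : IsPolyadicSpace S) (X : ExactType S) {T : Type v}
    {n m : T → C} (σ : ∀ τ, n τ ⟶ m τ) (t : ∀ τ, S.obj (op (m τ))) (p : ∀ τ, Pts X.left (n τ))
    (h : ∀ τ, S.map (σ τ).op (t τ) ≤ X.toSType.val (p τ)) :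
    ∃ (Y : ExactType S) (f : X ⟶ Y), ∀ τ, Y.Realizes (σ τ) (t τ) (Pts.push f.left (p τ)) := by
  obtain ⟨Y, -, hY⟩ := exists_hom_forall (D := Under X)
    (fun J _ _ =>
      have : HasColimitsOfShape J (ExactType S) := inferInstance
      hasColimitsOfShape_under X)
    (fun τ Y => Y.right.Realizes (σ τ) (t τ) (Pts.push Y.hom.left (p τ)))
    (fun τ Y Z f hY => by
      have := hY.push f.right
      rwa [← Pts.push_comp, ← CostructuredArrow.comp_left, Under.w] at this)
    (fun τ Y => by
      obtain ⟨Z, f, hZ⟩ := Y.right.exists_realizes hS (σ τ) (t τ) (Pts.push Y.hom.left (p τ))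
        ((h τ).trans_eq (val_push _ _).symm)
      refine ⟨Under.mk (Y.hom ≫ f), ⟨Under.homMk f rfl⟩, ?_⟩
      rwa [← Pts.push_comp] at hZ)
    (Under.mk (𝟙 X))
  exact ⟨Y.right, Y.hom, hY⟩

variable [EssentiallySmall.{v} C]

/-- All instances of saturation that concern points of `X` can be met in one exact extension `Y`.
(Those that concern new points of `Y` are not considered.) -/
theorem exists_realizes_all (hS : IsPolyadicSpace S) (X : ExactType S) :
    ∃ (Y : ExactType S) (f : X ⟶ Y), ∀ {n m : C} (σ : n ⟶ m) (t : S.obj (op m))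
      (p : Pts X.left n), S.map σ.op t ≤ X.toSType.val p →
        Y.Realizes σ t (Pts.push f.left p) := by
  let e := equivSmallModel.{v} C
  let T : Type v := Σ (a b : SmallModel.{v} C) (σ : e.inverse.obj a ⟶ e.inverse.obj b),
    {x : S.obj (op (e.inverse.obj b)) × Pts X.left (e.inverse.obj a) //
      S.map σ.op x.1 ≤ X.toSType.val x.2}
  obtain ⟨Y, f, hf⟩ := X.exists_realizes_family hS (T := T) (fun τ => τ.2.2.1)
    (fun τ => τ.2.2.2.1.1) (fun τ => τ.2.2.2.1.2) (fun τ => τ.2.2.2.2)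
  refine ⟨Y, f, fun {n m} σ t p h => ?_⟩
  let α := e.unitIso.app n
  let β := e.unitIso.app m
  -- Transport the instance to the small skeleton along the isomorphisms `α` and `β`.
  obtain ⟨q, hq, hq'⟩ := hf ⟨e.functor.obj n, e.functor.obj m, α.inv ≫ σ ≫ β.hom,
    ⟨(S.map β.inv.op t, Pts.restr α.inv p), by
      have := SType.monotone_map S α.inv h
      simp only [SType.map_comp_apply]
      rw [SType.val_restr, ← SType.map_comp_apply S β.hom, β.hom_inv_id]
      simpa using this⟩⟩
  refine ⟨Pts.restr β.hom q, ?_, ?_⟩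
  · have := SType.monotone_map S β.hom hq
    rw [SType.val_restr]
    refine le_trans (le_of_eq ?_) this
    change t = S.map β.hom.op (S.map β.inv.op t)
    rw [← SType.map_comp_apply, β.hom_inv_id]
    simp
  · have := congrArg (Pts.restr α.hom) hq'
    dsimp only at this
    rw [← Pts.restr_push, ← Pts.restr_comp, ← Pts.restr_comp, α.hom_inv_id,
      α.hom_inv_id_assoc, Pts.restr_comp] at this
    simpa [Pts.restr] using this

/-- Every exact type has an `ω`-saturated exact extension. -/
theorem exists_isOmegaSaturated (hS : IsPolyadicSpace S) (X : ExactType S) :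
    ∃ (Y : ExactType S) (_ : X ⟶ Y), Y.toSType.IsOmegaSaturated := by
  choose next toNext hnext using fun X : ExactType S => X.exists_realizes_all hS
  let Z (k : ℕ) : ExactType S := Nat.rec X (fun _ Y => next Y) k
  let F : ℕ ⥤ ExactType S := Functor.ofSequence (X := Z) fun k => toNext (Z k)
  refine ⟨colimit F, colimit.ι F 0, fun {n m} σ t p h => ?_⟩
  obtain ⟨k, p, rfl⟩ := exists_push_colimit_ι F p
  rw [val_push] at h
  have hk : F.map (homOfLE k.le_succ) = toNext (Z k) :=
    Functor.ofSequence_map_homOfLE_succ (fun k => toNext (Z k)) k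
  have hF : (F.obj (k + 1)).Realizes σ t (Pts.push (F.map (homOfLE k.le_succ)).left p) := by
    rw [hk]
    exact hnext (Z k) σ t p h
  have := hF.push (colimit.ι F (k + 1))
  rwa [← push_comp_left, colimit.w] at this

end ExactType

end Exact

/-! ### Oplax colimits of ind-objects -/

section Kripke

variable {C : Type u} [Category.{v} C]

/-- Ind-objects send pushouts to weak pullbacks, as their categories of elements are filtered. -/
theorem Pts.exists_of_isPushout (X : Ind C) {a b c d : C} {f : a ⟶ b} {g : a ⟶ c} {i : b ⟶ d}
    {j : c ⟶ d} (h : IsPushout f g i j) (p : Pts X b) (q : Pts X c)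
    (hpq : Pts.restr f p = Pts.restr g q) :
    ∃ r : Pts X d, Pts.restr i r = p ∧ Pts.restr j r = q := by
  have : IsFiltered (CostructuredArrow yoneda ((Ind.inclusion C).obj X)) :=
    X.isIndObject_inclusion_obj.isFiltered
  let mk {n : C} (p : Pts X n) : CostructuredArrow yoneda ((Ind.inclusion C).obj X) :=
    CostructuredArrow.mk (yonedaEquiv.symm p)
  have restr_eq {n m : C} (σ : n ⟶ m) (r : Pts X m) :
      yoneda.map σ ≫ yonedaEquiv.symm r = yonedaEquiv.symm (Pts.restr σ r) :=
    yonedaEquiv_symm_naturality_left σ _ r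
  let f' : mk (Pts.restr f p) ⟶ mk p := CostructuredArrow.homMk f (restr_eq f p)
  let g' : mk (Pts.restr f p) ⟶ mk q := CostructuredArrow.homMk g (by rw [hpq]; exact restr_eq g q)
  obtain ⟨k, s, t, hst⟩ := IsFiltered.span f' g'
  have hs : Pts.restr s.left (yonedaEquiv k.hom) = p := by
    apply yonedaEquiv.symm.injective
    rw [← restr_eq, Equiv.symm_apply_apply]
    exact CostructuredArrow.w s
  have ht : Pts.restr t.left (yonedaEquiv k.hom) = q := by
    apply yonedaEquiv.symm.injective
    rw [← restr_eq, Equiv.symm_apply_apply]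
    exact CostructuredArrow.w t
  obtain ⟨l, hl, hl'⟩ := h.exists_desc s.left t.left (congrArg CommaMorphism.left hst)
  refine ⟨Pts.restr l (yonedaEquiv k.hom), ?_, ?_⟩
  · rw [← Pts.restr_comp, hl, hs]
  · rw [← Pts.restr_comp, hl', ht]

theorem isPolyadicPoset_oplaxColimit {I : Type w₁} [Category.{w₂} I] (F : I ⥤ Ind C) :
    IsPolyadicPoset (oplaxColimit F) where
  interpolation {a b c d f g i j} h p q hpq := by
    induction p using Antisymmetrization.ind with | _ p
    induction q using Antisymmetrization.ind with | _ q
    obtain ⟨k, hk⟩ : OplaxPt.restr F f p ≤ OplaxPt.restr F g q := hpq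
    obtain ⟨r, hr, hr'⟩ := Pts.exists_of_isPushout (F.obj q.idx) h (Pts.push (F.map k) p.pt) q.pt
      ((Pts.restr_push _ _ _).trans hk)
    refine ⟨toAntisymmetrization (α := OplaxPt F d) (· ≤ ·) ⟨q.idx, r⟩, ?_, ?_⟩
    · exact (show p ≤ OplaxPt.restr F i ⟨q.idx, r⟩ from ⟨k, hr.symm⟩)
    · exact (show (⟨q.idx, Pts.restr j r⟩ : OplaxPt F c) ≤ q from
        ⟨𝟙 q.idx, by simpa [Pts.push] using hr'⟩)
  bounded {n m} σ := boundedMap_of_exists_ge fun p q hpq => by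
    induction p using Antisymmetrization.ind with | _ p
    induction q using Antisymmetrization.ind with | _ q
    obtain ⟨k, hk⟩ : OplaxPt.restr F σ p ≤ q := hpq
    refine ⟨toAntisymmetrization (α := OplaxPt F m) (· ≤ ·) ⟨q.idx, Pts.push (F.map k) p.pt⟩,
      (show p ≤ ⟨q.idx, Pts.push (F.map k) p.pt⟩ from ⟨k, rfl⟩), ?_⟩
    refine congrArg (toAntisymmetrization (α := OplaxPt F n) (· ≤ ·)) ?_
    exact congrArg (OplaxPt.mk q.idx) ((Pts.restr_push _ _ _).trans hk)

variable {S : Cᵒᵖ ⥤ KOrd.{v}}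

/-! ### Kripke models -/

theorem isPolyadicPoset_toPartOrd (hS : IsPolyadicSpace S) :
    IsPolyadicPoset (S ⋙ KOrd.toPartOrd) :=
  ⟨hS.interpolation, hS.bounded⟩

/-- The two Kripke conditions are boundedness and one of the interpolation properties; the other one
is saturation of the models. -/
theorem isIntuitionistic_kripkeHom {I : Type w₁} [Category.{w₂} I] {G : I ⥤ ModOmega S}
    (himp : KripkeImplication G) (huniv : KripkeUniversal G) : (kripkeHom G).IsIntuitionistic where
  bounded n := boundedMap_of_exists_ge fun p s hps => by
    induction p using Antisymmetrization.ind with | _ p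
    obtain ⟨j, f, hf⟩ := himp p.idx p.pt s hps
    exact ⟨toAntisymmetrization (α := OplaxPt (underlyingDiagram G) n) (· ≤ ·)
      ⟨j, Pts.push (G.map f).hom.hom p.pt⟩,
      (show p ≤ ⟨j, Pts.push (G.map f).hom.hom p.pt⟩ from ⟨f, rfl⟩), hf⟩
  interpolation_le {n m} σ t p h := by
    induction p using Antisymmetrization.ind with | _ p
    obtain ⟨q, hq, hq'⟩ := (G.obj p.idx).property σ t p.pt h
    refine ⟨toAntisymmetrization (α := OplaxPt (underlyingDiagram G) m) (· ≤ ·) ⟨p.idx, q⟩, hq, ?_⟩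
    exact (congrArg (fun x => toAntisymmetrization (α := OplaxPt (underlyingDiagram G) n) (· ≤ ·)
      ⟨p.idx, x⟩) hq').le
  interpolation_ge {n m} σ p t h := by
    induction p using Antisymmetrization.ind with | _ p
    obtain ⟨j, f, q, hq, hq'⟩ := huniv p.idx σ p.pt t h
    exact ⟨toAntisymmetrization (α := OplaxPt (underlyingDiagram G) m) (· ≤ ·) ⟨j, q⟩,
      (show p ≤ ⟨j, Pts.restr σ q⟩ from ⟨f, hq.symm⟩), hq'⟩

variable [HasPushouts C] [EssentiallySmall.{v} C]

/-- Every type has an `ω`-saturated extension in which its points keep their values. -/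
theorem SType.exists_modOmega (hS : IsPolyadicSpace S) (X : SType S) :
    ∃ (M : ModOmega S) (f : X ⟶ M.obj), ∀ {n : C} (p : Pts X.ind n),
      M.obj.val (Pts.push f.hom p) = X.val p := by
  obtain ⟨Y, f, hY⟩ := ExactType.exists_isOmegaSaturated hS (CostructuredArrow.mk X.trans)
  exact ⟨⟨Y.toSType, hY⟩, ⟨f.left, fun p => (ExactType.val_push f p).ge⟩, ExactType.val_push f⟩

theorem kripkeImplication_id (hS : IsPolyadicSpace S) : KripkeImplication (𝟭 (ModOmega S)) := by
  intro X n p s h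
  obtain ⟨Z, f, hf⟩ := X.obj.exists_extension_eq hS s p h
  obtain ⟨M, g, hg⟩ := Z.exists_modOmega hS
  refine ⟨M, ObjectProperty.homMk (f ≫ g), ?_⟩
  refine Eq.trans ?_ ((hg _).trans hf)
  exact congrArg M.obj.val (Pts.push_comp f.hom g.hom p)

theorem kripkeUniversal_id (hS : IsPolyadicSpace S) : KripkeUniversal (𝟭 (ModOmega S)) := by
  intro X n m σ p t h
  obtain ⟨Z, f, q, hq, hqt⟩ := X.obj.exists_extension_le hS σ t p h
  obtain ⟨M, g, hg⟩ := Z.exists_modOmega hS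
  refine ⟨M, ObjectProperty.homMk (f ≫ g), Pts.push g.hom q, ?_, (hg q).trans_le hqt⟩
  exact (Pts.restr_push _ _ _).trans
    ((congrArg (Pts.push g.hom) hq).trans (Pts.push_comp f.hom g.hom p).symm)

/-- Completeness: the representable ind-object of `n` with the type `s` extends to a model. -/
theorem exists_modOmega_val_eq (hS : IsPolyadicSpace S) (n : C) (s : S.obj (op n)) :
    ∃ (M : ModOmega S) (p : Pts M.obj.ind n), M.obj.val p = s := by
  let e : (Ind.inclusion C).obj (Ind.yoneda.obj n) ≅ yoneda.obj n := Ind.yonedaCompInclusion.app n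
  let φ : yoneda.obj n ⟶ S ⋙ forget KOrd.{v} := (yonedaEquiv (F := S ⋙ forget KOrd.{v})).symm s
  let X : SType S := ⟨Ind.yoneda.obj n, e.hom ≫ φ⟩
  obtain ⟨M, f, hf⟩ := X.exists_modOmega hS
  refine ⟨M, _, (hf (e.inv.app (op n) (𝟙 n))).trans ?_⟩
  have : e.inv ≫ X.trans = φ := e.inv_hom_id_assoc _
  refine (ConcreteCategory.congr_hom (congr_app this (op n)) (𝟙 n)).trans ?_
  exact (yonedaEquiv (F := S ⋙ forget KOrd.{v})).apply_symm_apply s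

end Kripke

theorem mainTheorem5 {C : Type u} [Category.{v} C] [EssentiallySmall.{v} C] [HasPushouts C]
    (S : Cᵒᵖ ⥤ KOrd.{v}) (hS : IsPolyadicSpace S) :
    IsOmegaSaturatedKripkeModel (𝟭 (ModOmega S)) ∧
    (KripkeImplication (𝟭 (ModOmega S)) ∧ KripkeUniversal (𝟭 (ModOmega S))) ∧
    (∀ (n : C) (s : S.obj (op n)), ∃ (M : ModOmega S) (x : Pts M.obj.ind n), M.obj.val x = s) :=
  ⟨⟨isPolyadicPoset_oplaxColimit _, isPolyadicPoset_toPartOrd hS,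
    isIntuitionistic_kripkeHom (kripkeImplication_id hS) (kripkeUniversal_id hS)⟩,
    ⟨kripkeImplication_id hS, kripkeUniversal_id hS⟩, exists_modOmega_val_eq hS⟩
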